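/- All graphs are finite, simple and undirected. For a graph $G$, let $\delta(G)$ denote its minimum degree and $\mu(G)$ the largest eigenvalue of its adjacency matrix. A graph $G$ is traceable from every vertex if for each vertex $x$ of $G$ there is a Hamiltonian path of $G$ (a path containing all vertices of $G$) having $x$ as an end. Write $K_m$ for the complete graph on $m$ vertices, $G_1+G_2$ for the disjoint union of $G_1$ and $G_2$, and $G_1\vee G_2$ for their join, obtained from $G_1+G_2$ by adding all edges between $G_1$ and $G_2$. Theorem. Let $k\ge 1$ and $n\ge 2(k+1)^2$ be integers, and let $G$ be a graph of order $n$ with $\delta(G)\ge k$. If $$\mu(G)\ \ge\ \frac{n^2}{n-1}-\frac{nk}{n-1}-\frac{2}{\sqrt{n-2}},$$ then $G$ is traceable from every vertex, unless $G$ is isomorphic to $K_1\vee(K_{n-k-1}+K_k)$. -/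

import Mathlib

namespace GraphTrace

/-- The join `G₁ ∨ G₂`: the disjoint union of `G₁` and `G₂` together with all edges between
a vertex of `G₁` and a vertex of `G₂`. -/
def join {V W : Type*} (G : SimpleGraph V) (H : SimpleGraph W) : SimpleGraph (V ⊕ W) :=
  SimpleGraph.sum G H ⊔ completeBipartiteGraph V W

/-- The largest eigenvalue `μ(G)` of the (real symmetric) adjacency matrix of `G`. -/
noncomputable def largestEigenvalue {V : Type*} [Fintype V] [DecidableEq V]
    (G : SimpleGraph V) [DecidableRel G.Adj] : ℝ :=
  sSup {μ : ℝ | Module.End.HasEigenvalue (Matrix.toLin' (G.adjMatrix ℝ)) μ}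

/-- On a nonempty vertex set the supremum above is a maximum. -/
theorem isGreatest_largestEigenvalue {V : Type*} [Fintype V] [DecidableEq V] [Nonempty V]
    (G : SimpleGraph V) [DecidableRel G.Adj] :
    IsGreatest {μ : ℝ | Module.End.HasEigenvalue (Matrix.toLin' (G.adjMatrix ℝ)) μ}
      (largestEigenvalue G) := by
  have hA : (G.adjMatrix ℝ).IsHermitian := by
    rw [Matrix.IsHermitian, Matrix.conjTranspose_eq_transpose_of_trivial]
    exact G.isSymm_adjMatrix
  have hS : {μ : ℝ | Module.End.HasEigenvalue (Matrix.toLin' (G.adjMatrix ℝ)) μ}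
      = Set.range hA.eigenvalues := by
    rw [← hA.spectrum_real_eq_range_eigenvalues, ← Matrix.spectrum_toLin']
    ext μ
    exact Module.End.hasEigenvalue_iff_mem_spectrum
  have hfin : (Set.range hA.eigenvalues).Finite := Set.finite_range _
  have hne : (Set.range hA.eigenvalues).Nonempty := Set.range_nonempty _
  rw [largestEigenvalue, hS]
  exact ⟨hne.csSup_mem hfin, fun _ h => le_csSup hfin.bddAbove h⟩

/-- `G` is traceable from every vertex: every vertex is an end of a Hamiltonian path of `G`. -/
def TraceableFromEveryVertex {V : Type*} [DecidableEq V] (G : SimpleGraph V) : Prop :=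
  ∀ x : V, ∃ (y : V) (p : G.Walk x y), p.IsHamiltonian

/-- The graph `K₁ ∨ (K_{n-k-1} + K_k)`. -/
def exceptionalGraph (n k : ℕ) : SimpleGraph (Fin 1 ⊕ (Fin (n - k - 1) ⊕ Fin k)) :=
  join (SimpleGraph.completeGraph (Fin 1))
    (SimpleGraph.sum (SimpleGraph.completeGraph (Fin (n - k - 1))) (SimpleGraph.completeGraph (Fin k)))

end GraphTrace

/-!
The spectral bound forces `μ(G) ≥ n - k`: it equals `n - k + 1` up to the small error
`(k - 1) / (n - 1) + 2 / √(n - 2) ≤ 1`. By Cauchy–Schwarz `μ(G)² ≤ ∑ deg`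
(`sq_le_sum_degrees_of_hasEigenvalue`), so `G` has degree sum at least `(n - k)²`, and it remains
to see that a graph with minimum degree at least `k` and so many edges is traceable from every
vertex. The graph `K₁ ∨ (K_{n-k-1} + K_k)` itself lies strictly below the spectral bound, so the
argument ends in the first alternative.

Fix `x` and suppose that no Hamiltonian path starts at `x`. Let `H ≥ G` be edge-maximal with that
property. For nonadjacent `u ≠ v`, the graph `H + uv` has a Hamiltonian path from `x`, and it runs
through `uv`. If `deg u + deg v ≥ n`, reversing a segment of this path would give a Hamiltonian
path of `H` from `x`, so `deg u + deg v ≤ n - 1` (`HamiltonianOrder.degree_add_degree_lt`).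
Now choose nonadjacent `u ≠ v` with `deg u + deg v` largest and `h = deg u ≤ deg v`. At least `h`
vertices are nonadjacent to `v`, all of degree at most `h`, and the `n - h` vertices nonadjacent or
equal to `u` have degree at most `n - 1 - h`. Hence the degree sum of `H` is at most
`n (n - 1) - h (2n - 1 - 3h)` (`exists_sum_degrees_le`), which for `k ≤ h ≤ (n - 1) / 2` and
`n ≥ 2 (k + 1)²` is smaller than `(n - k)²`.
-/

open Finset

namespace GraphTrace

variable {V : Type*}

/-! ### Hamiltonian paths as orderings of the vertices -/

theorem exists_walk_support_eq {G : SimpleGraph V} {p : ℕ → V} (m : ℕ)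
    (h : ∀ j < m, G.Adj (p j) (p (j + 1))) :
    ∃ w : G.Walk (p 0) (p m), w.support = (List.range (m + 1)).map p := by
  induction m with
  | zero => exact ⟨.nil, by simp⟩
  | succ m ih =>
    obtain ⟨w, hw⟩ := ih fun j hj => h j (by omega)
    refine ⟨w.concat (h m (by omega)), ?_⟩
    rw [SimpleGraph.Walk.support_concat, hw, List.range_succ (n := m + 1)]
    simp

variable [Fintype V]

/-- `p 0, p 1, …, p (n - 1)` is a Hamiltonian path of `G` starting at `x`, where `n` is the number
of vertices; the values of `p` from `n` on are irrelevant. -/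
structure HamiltonianOrder (G : SimpleGraph V) (x : V) (p : ℕ → V) : Prop where
  zero : p 0 = x
  injOn : Set.InjOn p (Set.Iio (Fintype.card V))
  adj : ∀ m, m + 1 < Fintype.card V → G.Adj (p m) (p (m + 1))

theorem image_range_card_of_injOn [DecidableEq V] {p : ℕ → V}
    (hp : Set.InjOn p (Set.Iio (Fintype.card V))) :
    (range (Fintype.card V)).image p = univ := by
  apply eq_univ_of_card
  rw [card_image_of_injOn (by simpa using hp), card_range]

theorem HamiltonianOrder.exists_isHamiltonian [DecidableEq V] {G : SimpleGraph V} {x : V}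
    {p : ℕ → V} (hp : HamiltonianOrder G x p) :
    ∃ (y : V) (w : G.Walk x y), w.IsHamiltonian := by
  obtain rfl := hp.zero
  have hpos : 0 < Fintype.card V := Fintype.card_pos_iff.2 ⟨p 0⟩
  obtain ⟨w, hw⟩ := exists_walk_support_eq (G := G) (p := p) (Fintype.card V - 1)
    fun j hj => hp.adj j (by omega)
  rw [Nat.sub_add_cancel hpos] at hw
  refine ⟨_, w, SimpleGraph.Walk.IsPath.isHamiltonian_of_mem ?_ fun v => ?_⟩
  · rw [SimpleGraph.Walk.isPath_def, hw]
    exact List.Nodup.map_on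
      (fun a ha b hb hab => hp.injOn (by simpa using ha) (by simpa using hb) hab) List.nodup_range
  · have := mem_univ v
    rw [← image_range_card_of_injOn hp.injOn] at this
    rw [hw]
    simpa using this

theorem exists_hamiltonianOrder_top (x : V) :
    ∃ p, HamiltonianOrder (⊤ : SimpleGraph V) x p := by
  classical
  have hpos : 0 < Fintype.card V := Fintype.card_pos_iff.2 ⟨x⟩
  let e := (Fintype.equivFin V).symm
  let σ := e.trans (Equiv.swap (e ⟨0, hpos⟩) x)
  have hinj : Set.InjOn (fun m => if h : m < Fintype.card V then σ ⟨m, h⟩ else x)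
      (Set.Iio (Fintype.card V)) := by
    intro a ha b hb hab
    have ha' : a < Fintype.card V := ha
    have hb' : b < Fintype.card V := hb
    simpa [ha', hb'] using hab
  refine ⟨fun m => if h : m < Fintype.card V then σ ⟨m, h⟩ else x, ?_, hinj, fun m hm => ?_⟩
  · simp [hpos, σ]
  · rw [SimpleGraph.top_adj]
    intro h
    have := hinj (show m < Fintype.card V by omega) hm h
    omega

/-! ### Rerouting by reversing a segment -/

/-- Reverses the segment `[a, b]` of the natural numbers and fixes everything else. -/
def reverseSegment (a b m : ℕ) : ℕ := if a ≤ m ∧ m ≤ b then a + b - m else m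

/-- Reversing the segment from position `a` to position `b` of an ordering only creates the
consecutive pairs `(p (a - 1), p b)` and `(p a, p (b + 1))`, the latter only if the segment stops
before the last position. -/
theorem HamiltonianOrder.of_reverseSegment {H : SimpleGraph V} {p : ℕ → V} {a b : ℕ}
    (hinj : Set.InjOn p (Set.Iio (Fintype.card V))) (ha : 1 ≤ a) (hab : a ≤ b)
    (hb : b < Fintype.card V)
    (hadj : ∀ m, m + 1 < Fintype.card V → m + 1 ≠ a → m ≠ b → H.Adj (p m) (p (m + 1)))
    (hleft : H.Adj (p (a - 1)) (p b))
    (hright : b + 1 < Fintype.card V → H.Adj (p a) (p (b + 1))) :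
    HamiltonianOrder H (p 0) (p ∘ reverseSegment a b) := by
  refine ⟨?_, ?_, fun m hm => ?_⟩
  · have : reverseSegment a b 0 = 0 := by unfold reverseSegment; split_ifs <;> omega
    simp [this]
  · intro i hi j hj hij
    simp only [Set.mem_Iio] at hi hj
    have h1 : reverseSegment a b i < Fintype.card V := by
      unfold reverseSegment; split_ifs <;> omega
    have h2 : reverseSegment a b j < Fintype.card V := by
      unfold reverseSegment; split_ifs <;> omega
    have h3 := hinj h1 h2 hij
    unfold reverseSegment at h3
    split_ifs at h3 <;> omega
  · simp only [Function.comp_apply]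
    rcases lt_trichotomy (m + 1) a with h | h | h
    · have e1 : reverseSegment a b m = m := by unfold reverseSegment; split_ifs <;> omega
      have e2 : reverseSegment a b (m + 1) = m + 1 := by
        unfold reverseSegment; split_ifs <;> omega
      rw [e1, e2]
      exact hadj m hm (by omega) (by omega)
    · have e1 : reverseSegment a b m = a - 1 := by unfold reverseSegment; split_ifs <;> omega
      have e2 : reverseSegment a b (m + 1) = b := by unfold reverseSegment; split_ifs <;> omega
      rw [e1, e2]
      exact hleft
    rcases lt_trichotomy m b with h' | h' | h'
    · have e1 : reverseSegment a b m = a + b - (m + 1) + 1 := by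
        unfold reverseSegment; split_ifs <;> omega
      have e2 : reverseSegment a b (m + 1) = a + b - (m + 1) := by
        unfold reverseSegment; split_ifs <;> omega
      rw [e1, e2]
      exact (hadj _ (by omega) (by omega) (by omega)).symm
    · have e1 : reverseSegment a b m = a := by unfold reverseSegment; split_ifs <;> omega
      have e2 : reverseSegment a b (m + 1) = b + 1 := by
        unfold reverseSegment; split_ifs <;> omega
      rw [e1, e2]
      exact hright (by omega)
    · have e1 : reverseSegment a b m = m := by unfold reverseSegment; split_ifs <;> omega
      have e2 : reverseSegment a b (m + 1) = m + 1 := by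
        unfold reverseSegment; split_ifs <;> omega
      rw [e1, e2]
      exact hadj m hm (by omega) (by omega)

theorem degree_eq_card_filter_range {H : SimpleGraph V} [DecidableRel H.Adj] {p : ℕ → V}
    (hp : Set.InjOn p (Set.Iio (Fintype.card V))) (u : V) :
    H.degree u = #{j ∈ range (Fintype.card V) | H.Adj u (p j)} := by
  classical
  rw [← SimpleGraph.card_neighborFinset_eq_degree, H.neighborFinset_eq_filter,
    ← image_range_card_of_injOn hp, filter_image, card_image_of_injOn]
  exact hp.mono fun j hj => by simp only [coe_filter, mem_range] at hj; exact hj.1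

/-- The Ore-type crossing argument for an ordering whose only defect is the pair at positions
`i`, `i + 1`: a neighbour `p j` of `p i` whose successor is a neighbour of `p (i + 1)` permits a
rerouting, as does the last vertex if it is a neighbour of `p i`. -/
theorem degree_add_degree_lt_of_defect {H : SimpleGraph V} [DecidableRel H.Adj] {x : V}
    (hH : ∀ q, ¬ HamiltonianOrder H x q) {p : ℕ → V} (hzero : p 0 = x)
    (hinj : Set.InjOn p (Set.Iio (Fintype.card V))) {i : ℕ} (hi : i + 1 < Fintype.card V)
    (hdefect : ¬ H.Adj (p i) (p (i + 1)))
    (hadj : ∀ m, m + 1 < Fintype.card V → m ≠ i → H.Adj (p m) (p (m + 1))) :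
    H.degree (p i) + H.degree (p (i + 1)) < Fintype.card V := by
  subst hzero
  have hlast : ∀ j, H.Adj (p i) (p j) → j < Fintype.card V → j + 1 < Fintype.card V := by
    intro j hj hjn
    by_contra hlt
    have hij : i + 1 ≤ j := by omega
    exact hH _ (HamiltonianOrder.of_reverseSegment hinj (a := i + 1) (b := j) (by omega) hij hjn
      (fun m hm h1 _ => hadj m hm (by omega)) (by simpa using hj) (fun h => absurd h hlt))
  have hcross : ∀ j, j + 1 < Fintype.card V → H.Adj (p i) (p j) →
      ¬ H.Adj (p (i + 1)) (p (j + 1)) := by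
    intro j hjn hj hj'
    rcases lt_trichotomy j i with hlt | rfl | hlt
    · exact hH _ (HamiltonianOrder.of_reverseSegment hinj (a := j + 1) (b := i) (by omega) hlt
        (by omega) (fun m hm _ h => hadj m hm h) (by simpa using hj.symm) (fun _ => hj'.symm))
    · exact H.loopless.irrefl _ hj
    · exact hH _ (HamiltonianOrder.of_reverseSegment hinj (a := i + 1) (b := j) (by omega) hlt
        (by omega) (fun m hm h _ => hadj m hm (by omega)) (by simpa using hj) (fun _ => hj'))
  rw [degree_eq_card_filter_range hinj, degree_eq_card_filter_range hinj]
  set A := {j ∈ range (Fintype.card V) | H.Adj (p i) (p j)} with hA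
  set B := {j ∈ range (Fintype.card V) | H.Adj (p (i + 1)) (p j)} with hB
  have hcardA : #(A.image Nat.succ) = #A := card_image_of_injective _ Nat.succ_injective
  have hdisj : Disjoint (A.image Nat.succ) B := by
    rw [disjoint_left]
    intro m hm hmB
    obtain ⟨j, hjA, rfl⟩ := mem_image.1 hm
    simp only [hA, hB, mem_filter, mem_range] at hjA hmB
    exact hcross j hmB.1 hjA.2 hmB.2
  -- Position `i + 1` is missed both by the neighbours of `p (i + 1)` and by the shifted
  -- neighbours of `p i`.
  have hsub : A.image Nat.succ ∪ B ⊆ (range (Fintype.card V)).erase (i + 1) := by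
    intro m hm
    rw [mem_erase, mem_range]
    rcases mem_union.1 hm with hm | hm
    · obtain ⟨j, hjA, rfl⟩ := mem_image.1 hm
      simp only [hA, mem_filter, mem_range] at hjA
      refine ⟨?_, hlast j hjA.2 hjA.1⟩
      rintro h
      obtain rfl : j = i := Nat.succ_injective h
      exact H.loopless.irrefl _ hjA.2
    · simp only [hB, mem_filter, mem_range] at hm
      refine ⟨?_, hm.1⟩
      rintro rfl
      exact H.loopless.irrefl _ hm.2
  have := card_le_card hsub
  rw [card_union_of_disjoint hdisj, hcardA, card_erase_of_mem (mem_range.2 hi), card_range] at this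
  omega

/-- If adding the edge `uv` creates a Hamiltonian path from `x`, then `deg u + deg v < n`. -/
theorem HamiltonianOrder.degree_add_degree_lt {H : SimpleGraph V} [DecidableRel H.Adj] {x u v : V}
    (hH : ∀ q, ¬ HamiltonianOrder H x q) {p : ℕ → V}
    (hp : HamiltonianOrder (H ⊔ SimpleGraph.edge u v) x p) :
    H.degree u + H.degree v < Fintype.card V := by
  have hedge : ∀ m, m + 1 < Fintype.card V → ¬ H.Adj (p m) (p (m + 1)) →
      (p m = u ∧ p (m + 1) = v) ∨ (p m = v ∧ p (m + 1) = u) := by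
    intro m hm hna
    have := hp.adj m hm
    rw [SimpleGraph.sup_adj, SimpleGraph.edge_adj] at this
    exact (this.resolve_left hna).1
  obtain ⟨i, hi, hna⟩ : ∃ i, i + 1 < Fintype.card V ∧ ¬ H.Adj (p i) (p (i + 1)) := by
    by_contra hcon
    push Not at hcon
    exact hH p ⟨hp.zero, hp.injOn, hcon⟩
  have hadj : ∀ m, m + 1 < Fintype.card V → m ≠ i → H.Adj (p m) (p (m + 1)) := by
    intro m hm hmi
    by_contra hna'
    have inj : ∀ a b, a < Fintype.card V → b < Fintype.card V → p a = p b → a = b :=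
      fun a b ha hb h => hp.injOn ha hb h
    rcases hedge i hi hna with ⟨h1, h2⟩ | ⟨h1, h2⟩ <;>
      rcases hedge m hm hna' with ⟨h3, h4⟩ | ⟨h3, h4⟩
    · exact hmi (inj m i (by omega) (by omega) (h3.trans h1.symm))
    · have e1 := inj m (i + 1) (by omega) hi (h3.trans h2.symm)
      have e2 := inj (m + 1) i hm (by omega) (h4.trans h1.symm)
      omega
    · have e1 := inj m (i + 1) (by omega) hi (h3.trans h2.symm)
      have e2 := inj (m + 1) i hm (by omega) (h4.trans h1.symm)
      omega
    · exact hmi (inj m i (by omega) (by omega) (h3.trans h1.symm))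
  have key := degree_add_degree_lt_of_defect hH hp.zero hp.injOn hi hna hadj
  rcases hedge i hi hna with ⟨h1, h2⟩ | ⟨h1, h2⟩ <;> rw [h1, h2] at key <;> omega

/-! ### Degree sums -/

/-- If nonadjacent vertices have degree sum less than `n` and the graph is not complete, then some
vertex degree `h < n / 2` bounds the degree sum of the graph by `n (n - 1) - h (2n - 1 - 3h)`. The
vertex is the one of smaller degree in a nonadjacent pair whose degree sum is largest. -/
theorem exists_sum_degrees_le {H : SimpleGraph V} [DecidableRel H.Adj] (htop : H ≠ ⊤)
    (hH : ∀ u v, u ≠ v → ¬ H.Adj u v → H.degree u + H.degree v < Fintype.card V) :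
    ∃ u, 2 * H.degree u < Fintype.card V ∧
      ∑ w, (H.degree w : ℤ) ≤ Fintype.card V * (Fintype.card V - 1)
        - H.degree u * (2 * Fintype.card V - 1 - 3 * H.degree u) := by
  classical
  set n := Fintype.card V with hn
  let P : Finset (V × V) := {e | e.1 ≠ e.2 ∧ ¬ H.Adj e.1 e.2}
  have hP : P.Nonempty := by
    by_contra hP
    rw [not_nonempty_iff_eq_empty] at hP
    apply htop
    ext a b
    rw [SimpleGraph.top_adj]
    refine ⟨fun h => h.ne, fun h => ?_⟩
    by_contra hab
    have : (a, b) ∈ P := by simp [P, h, hab]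
    simp [hP] at this
  obtain ⟨⟨u, v⟩, huv, hmax, hle⟩ : ∃ e ∈ P, (∀ a b, a ≠ b → ¬ H.Adj a b →
      H.degree a + H.degree b ≤ H.degree e.1 + H.degree e.2) ∧ H.degree e.1 ≤ H.degree e.2 := by
    obtain ⟨⟨u, v⟩, huv, hmax⟩ := exists_max_image P (fun e => H.degree e.1 + H.degree e.2) hP
    have hmax' : ∀ a b, a ≠ b → ¬ H.Adj a b →
        H.degree a + H.degree b ≤ H.degree u + H.degree v := fun a b hab hna =>
      hmax (a, b) (by simp [P, hab, hna])
    rcases le_total (H.degree u) (H.degree v) with h | h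
    · exact ⟨(u, v), huv, hmax', h⟩
    · refine ⟨(v, u), ?_, fun a b hab hna => (hmax' a b hab hna).trans (by simp [add_comm]), h⟩
      simp only [P, mem_filter, mem_univ, true_and] at huv ⊢
      exact ⟨huv.1.symm, fun h => huv.2 h.symm⟩
  simp only at hmax hle
  simp only [P, mem_filter, mem_univ, true_and] at huv
  have hsum := hH u v huv.1 huv.2
  refine ⟨u, by omega, ?_⟩
  set h := H.degree u with hh
  let S : Finset V := (H.neighborFinset v)ᶜ.erase v
  let T : Finset V := (H.neighborFinset u)ᶜ
  have hT : #T = n - h := by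
    rw [card_compl, SimpleGraph.card_neighborFinset_eq_degree]
  have hS : h ≤ #S := by
    rw [card_erase_of_mem (by simp), card_compl, SimpleGraph.card_neighborFinset_eq_degree]
    omega
  have hSdeg : ∀ w ∈ S, H.degree w ≤ h := by
    intro w hw
    simp only [S, mem_erase, mem_compl, SimpleGraph.mem_neighborFinset] at hw
    have := hmax w v hw.1 fun h => hw.2 h.symm
    omega
  have hTdeg : ∀ w ∈ T, H.degree w + h < n := by
    intro w hw
    simp only [T, mem_compl, SimpleGraph.mem_neighborFinset] at hw
    by_cases hwu : u = w
    · subst hwu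
      omega
    · have := hmax u w hwu hw
      omega
  -- Where `S` and `T` overlap the two deductions add up to `n - 1 - h`.
  have hpoint : ∀ w, (H.degree w : ℤ) ≤ (n - 1) - (if w ∈ T then (h : ℤ) else 0)
      - (if w ∈ S then (n - 1 - 2 * h : ℤ) else 0) := by
    intro w
    have h0 := H.degree_lt_card_verts w
    by_cases hwT : w ∈ T <;> by_cases hwS : w ∈ S <;> simp only [hwT, hwS, if_true, if_false]
    · have := hSdeg w hwS
      omega
    · have := hTdeg w hwT
      omega
    · have := hSdeg w hwS
      omega
    · omega
  have htotal := sum_le_sum fun w (_ : w ∈ univ) => hpoint w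
  simp only [sum_sub_distrib, sum_ite_mem, univ_inter, sum_const, card_univ, nsmul_eq_mul,
    hT] at htotal
  rw [← hn, Nat.cast_sub (by omega : h ≤ n)] at htotal
  have hS' : (h : ℤ) * (n - 1 - 2 * h) ≤ #S * (n - 1 - 2 * h) :=
    mul_le_mul_of_nonneg_right (by exact_mod_cast hS) (by omega)
  linarith

/-- A graph with minimum degree at least `k` and degree sum at least `(n - k)²` has a Hamiltonian
path from every vertex. -/
theorem exists_hamiltonianOrder_of_sum_degrees (G : SimpleGraph V) [DecidableRel G.Adj] (k : ℕ)
    (hcard : 2 * (k + 1) ^ 2 ≤ Fintype.card V) (hδ : k ≤ G.minDegree)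
    (hsum : ((Fintype.card V : ℤ) - k) ^ 2 ≤ ∑ w, (G.degree w : ℤ)) (x : V) :
    ∃ p, HamiltonianOrder G x p := by
  classical
  by_contra hG
  obtain ⟨H, hGH, hH⟩ :=
    Finite.exists_le_maximal (p := fun H : SimpleGraph V => ¬ ∃ p, HamiltonianOrder H x p) hG
  have hno : ∀ q, ¬ HamiltonianOrder H x q := not_exists.1 hH.prop
  have hne : H ≠ ⊤ := by
    rintro rfl
    exact hH.prop (exists_hamiltonianOrder_top x)
  obtain ⟨u, hu, hle⟩ := exists_sum_degrees_le hne fun u v huv hna => by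
    obtain ⟨p, hp⟩ := not_not.1 (hH.not_prop_of_gt (H.lt_sup_edge _ _ huv hna))
    exact hp.degree_add_degree_lt hno
  have hku : k ≤ H.degree u :=
    (hδ.trans (G.minDegree_le_degree u)).trans (SimpleGraph.degree_le_of_le hGH)
  have hmono : ∑ w, (G.degree w : ℤ) ≤ ∑ w, (H.degree w : ℤ) :=
    sum_le_sum fun w _ => Int.ofNat_le.2 (SimpleGraph.degree_le_of_le hGH)
  have hcard' : 2 * ((k : ℤ) + 1) ^ 2 ≤ Fintype.card V := by exact_mod_cast hcard
  have hkh : (k : ℤ) ≤ H.degree u := by exact_mod_cast hku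
  have hhn : 2 * (H.degree u : ℤ) < Fintype.card V := by exact_mod_cast hu
  generalize (Fintype.card V : ℤ) = n at *
  generalize (H.degree u : ℤ) = h at *
  -- The loss `h (2n - 1 - 3h)` is smallest at `h = k`.
  have hend : 0 ≤ (h - k) * (2 * n - 1 - 3 * (h + k)) :=
    mul_nonneg (by linarith) (by nlinarith [sq_nonneg ((k : ℤ) - 1)])
  nlinarith

/-! ### The spectral bound -/

/-- Every adjacency eigenvalue satisfies `μ² ≤ ∑ deg`: apply Cauchy–Schwarz in each coordinate of
the eigenvector equation and add up. -/
theorem sq_le_sum_degrees_of_hasEigenvalue [DecidableEq V] (G : SimpleGraph V)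
    [DecidableRel G.Adj] {μ : ℝ}
    (hμ : Module.End.HasEigenvalue (Matrix.toLin' (G.adjMatrix ℝ)) μ) :
    μ ^ 2 ≤ ∑ v, (G.degree v : ℝ) := by
  obtain ⟨x, hx⟩ := hμ.exists_hasEigenvector
  have hcoord : ∀ v, ∑ w ∈ G.neighborFinset v, x w = μ * x v := by
    intro v
    have := congrFun hx.apply_eq_smul v
    rwa [Matrix.toLin'_apply, SimpleGraph.adjMatrix_mulVec_apply] at this
  have hpos : 0 < ∑ w, x w ^ 2 := by
    obtain ⟨w, hw⟩ := Function.ne_iff.1 hx.2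
    exact sum_pos' (fun i _ => sq_nonneg _) ⟨w, mem_univ _, by
      have : x w ≠ 0 := hw
      positivity⟩
  have hpoint : ∀ v, μ ^ 2 * x v ^ 2 ≤ G.degree v * ∑ w, x w ^ 2 := by
    intro v
    rw [← mul_pow, ← hcoord, ← SimpleGraph.card_neighborFinset_eq_degree]
    exact sq_sum_le_card_mul_sum_sq.trans (mul_le_mul_of_nonneg_left
      (sum_le_sum_of_subset_of_nonneg (subset_univ _) fun _ _ _ => sq_nonneg _) (by positivity))
  have := sum_le_sum fun v (_ : v ∈ univ) => hpoint v
  rw [← mul_sum, ← sum_mul] at this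
  exact le_of_mul_le_mul_right this hpos

theorem sub_le_spectral_bound {n k : ℝ} (hk : 1 ≤ k)
    (hn : 2 * (k + 1) ^ 2 ≤ n) :
    n - k ≤ n ^ 2 / (n - 1) - n * k / (n - 1) - 2 / Real.sqrt (n - 2) := by
  have hn1 : 0 < n - 1 := by nlinarith
  have hsplit : n ^ 2 / (n - 1) - n * k / (n - 1) = (n - k) + 1 - (k - 1) / (n - 1) := by
    field_simp
    ring
  -- `n ≥ 8` makes the root at least `√6 > 12 / 5`, and `5 / 6 + 1 / 6 = 1` is the error allowed.
  have hroot : 12 / 5 ≤ Real.sqrt (n - 2) := Real.le_sqrt_of_sq_le (by nlinarith)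
  have h1 : 2 / Real.sqrt (n - 2) ≤ 5 / 6 := by
    rw [div_le_iff₀ (by linarith)]
    linarith
  have h2 : (k - 1) / (n - 1) ≤ 1 / 6 := by
    rw [div_le_iff₀ hn1]
    nlinarith [sq_nonneg (k - 1)]
  linarith

end GraphTrace

theorem theorem2p11 {V : Type*} [Fintype V] [DecidableEq V]
    (G : SimpleGraph V) [DecidableRel G.Adj] (k n : ℕ)
    (hk : 1 ≤ k) (hn : 2 * (k + 1) ^ 2 ≤ n)
    (hcard : Fintype.card V = n)
    (hδ : k ≤ G.minDegree)
    (hμ : (n : ℝ) ^ 2 / ((n : ℝ) - 1) - (n : ℝ) * (k : ℝ) / ((n : ℝ) - 1)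
        - 2 / Real.sqrt ((n : ℝ) - 2) ≤ GraphTrace.largestEigenvalue G) :
    GraphTrace.TraceableFromEveryVertex G ∨
      Nonempty (G ≃g GraphTrace.exceptionalGraph n k) := by
  subst hcard
  have : Nonempty V := Fintype.card_pos_iff.1 (by nlinarith)
  have hn' : 2 * ((k : ℝ) + 1) ^ 2 ≤ Fintype.card V := by exact_mod_cast hn
  have hle := (GraphTrace.sub_le_spectral_bound (by exact_mod_cast hk) hn').trans hμ
  have hsq := GraphTrace.sq_le_sum_degrees_of_hasEigenvalue G
    (GraphTrace.isGreatest_largestEigenvalue G).1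
  have hsum : ((Fintype.card V : ℝ) - k) ^ 2 ≤ ∑ v, (G.degree v : ℝ) :=
    (pow_le_pow_left₀ (by nlinarith) hle 2).trans hsq
  refine Or.inl fun x => ?_
  obtain ⟨p, hp⟩ := GraphTrace.exists_hamiltonianOrder_of_sum_degrees G k hn hδ
    (by exact_mod_cast hsum) x
  exact hp.exists_isHamiltonian
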